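/- Let $\mathbb{F}_q$ be a finite field with $q$ elements. A covering system of $\mathbb{F}_q[x]$ is a finite family of congruences $a_i+I_i$ ($1\le i\le m$), with $a_i\in\mathbb{F}_q[x]$ and $I_i\subsetneq\mathbb{F}_q[x]$ proper ideals (the moduli), such that $\bigcup_{i=1}^m(a_i+I_i)=\mathbb{F}_q[x]$. Its multiplicity is $\max_I\#\{1\le i\le m: I_i=I\}$, where $I$ runs over the ideals of $\mathbb{F}_q[x]$. Let $s\ge 1$ be an integer. If $q\ge 759s^2$, then there is no covering system of $\mathbb{F}_q[x]$ of multiplicity $s$. In particular, if $q\ge 759$, then there is no covering system of $\mathbb{F}_q[x]$ whose moduli $I_1,\dots,I_m$ are pairwise distinct. -/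

import Mathlib

/-- A covering system of a commutative ring `R`: a finite indexed family of congruences
`residue i + modulus i` (`i < m`) modulo proper ideals, whose union is all of `R`.
The same congruence, or the same modulus, may occur several times.  The unit ideal is not
allowed as a modulus, since a single congruence modulo it already covers `R`. -/
structure CoveringSystem (R : Type*) [CommRing R] where
  /-- the number of congruences -/
  m : ℕ
  /-- the representatives of the congruences -/
  residue : Fin m → R
  /-- the moduli of the congruences -/
  modulus : Fin m → Ideal R
  modulus_ne_top : ∀ i, modulus i ≠ ⊤
  covers : ⋃ i, {x : R | x - residue i ∈ modulus i} = Set.univ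

namespace CoveringSystem

variable {R : Type*} [CommRing R]

/-- The number of indices `i` whose modulus is the ideal `I`. -/
noncomputable def count (A : CoveringSystem R) (I : Ideal R) : ℕ :=
  Nat.card {i : Fin A.m // A.modulus i = I}

/-- The multiplicity: the maximum, over all ideals `I`, of the number of indices `i` whose
modulus is `I` (an honest maximum, see `isGreatest_multiplicity`). -/
noncomputable def multiplicity (A : CoveringSystem R) : ℕ :=
  ⨆ I : Ideal R, A.count I

theorem count_le (A : CoveringSystem R) (I : Ideal R) : A.count I ≤ A.m := by
  have h := Finite.card_subtype_le (fun i : Fin A.m => A.modulus i = I)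
  rwa [Nat.card_fin] at h

theorem isGreatest_multiplicity (A : CoveringSystem R) :
    IsGreatest (Set.range A.count) A.multiplicity := by
  have hb : BddAbove (Set.range A.count) := ⟨A.m, by rintro _ ⟨I, rfl⟩; exact A.count_le I⟩
  exact ⟨Nat.sSup_mem (Set.range_nonempty _) hb, fun _ hx => le_csSup hb hx⟩

end CoveringSystem

/-! The proof is the distortion method. Factor the nonzero moduli over monic irreducibles `p i`,
listed by increasing degree. By the Chinese remainder theorem a congruence modulo `∏ i, p i ^ v i`
becomes a box in a finite product, with side densities `N i ^ (-v i)`, where `N i = q ^ deg (p i)`.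

The boxes are removed one prime at a time, each at its last prime `t`. If these boxes cover a
proportion `α ≤ 1/2` of a fibre over the earlier coordinates, the weight on the rest of the fibre is
scaled up to restore its mean; otherwise the fibre is dropped (`IsSpreadWeight.exists_insert`).
Scaling distorts product averages by at most 2 per prime, and dropping loses at most four times the
second moment of `α`. Expanding that moment over pairs of boxes gives an Euler product over earlier
primes, times `s ^ 2` (`IsSpreadWeight.expect_sq_le`). There are at most `q ^ l` primes of degree
`l`, so the total loss is below 1 (`sum_moment_lt_one`): some weight survives, at an uncovered
point.

Zero moduli cover only finitely many points, whereas the uncovered set contains a full residue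
class. -/

section Sieve

open Finset Function
open scoped BigOperators

/-! ### Spread weights on finite products and the distortion step -/

/-- Averaging over one coordinate first does not change the average over a product. -/
lemma expect_pi_eq_expect_expect_update {ι : Type*} [Fintype ι] [DecidableEq ι] {X : ι → Type*}
    [∀ i, Fintype (X i)] [∀ i, Nonempty (X i)] (t : ι) (f : (∀ i, X i) → ℝ) :
    𝔼 x, f x = 𝔼 x, 𝔼 y, f (update x t y) := by
  have h1 : 𝔼 p : (∀ i, X i) × X t, f (update p.1 t p.2) = 𝔼 p : (∀ i, X i) × X t, f p.1 := by
    -- Exchanging `x t` with the extra coordinate is an involution.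
    refine Finset.expect_nbij' (fun p => (update p.1 t p.2, p.1 t))
      (fun p => (update p.1 t p.2, p.1 t)) ?_ ?_ ?_ ?_ ?_ <;> simp
  rw [← univ_product_univ, Finset.expect_product, Finset.expect_product] at h1
  simp only [Fintype.expect_const] at h1
  exact h1.symm

variable {ι : Type*} [Fintype ι] [DecidableEq ι] {X : ι → Type*}
  [∀ i, Fintype (X i)]

/-- A nonnegative weight on a product which depends only on the coordinates in `U`, and whose
average against product functions exceeds that of the uniform weight by at most a factor `2` for
each coordinate involved. -/
structure IsSpreadWeight (U : Finset ι) (w : (∀ i, X i) → ℝ) : Prop where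
  nonneg : ∀ x, 0 ≤ w x
  update_eq : ∀ x, ∀ i ∉ U, ∀ y, w (update x i y) = w x
  expect_le : ∀ τ : ∀ i, X i → ℝ, (∀ i y, 0 ≤ τ i y) → ∀ V ⊆ U,
    𝔼 x, w x * ∏ i ∈ V, τ i (x i) ≤ ∏ i ∈ V, 2 * 𝔼 y, τ i y

lemma isSpreadWeight_one [∀ i, Nonempty (X i)] :
    IsSpreadWeight ∅ (fun _ : ∀ i, X i => (1 : ℝ)) where
  nonneg _ := zero_le_one
  update_eq _ _ _ _ := rfl
  expect_le τ _ V hV := by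
    obtain rfl := subset_empty.1 hV
    simp

/-- Removing the set with indicator function `B` from a spread weight, by renormalising the
fibres of coordinate `t` of which at most half lies in `B` and discarding the others. -/
lemma IsSpreadWeight.exists_insert [∀ i, Nonempty (X i)] {U : Finset ι} {w : (∀ i, X i) → ℝ}
    (hw : IsSpreadWeight U w) {t : ι} (ht : t ∉ U) (B : (∀ i, X i) → ℝ)
    (hB : ∀ x, B x = 0 ∨ B x = 1) (hBU : ∀ x, ∀ i ∉ insert t U, ∀ y, B (update x i y) = B x) :
    ∃ w' : (∀ i, X i) → ℝ, IsSpreadWeight (insert t U) w' ∧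
      (∀ x, w x = 0 ∨ B x = 1 → w' x = 0) ∧
      𝔼 x, w x - 4 * 𝔼 x, w x * (𝔼 y, B (update x t y)) ^ 2 ≤ 𝔼 x, w' x := by
  set α : (∀ i, X i) → ℝ := fun x => 𝔼 y, B (update x t y) with hα
  set w' : (∀ i, X i) → ℝ := fun x => if α x ≤ 1 / 2 then w x / (1 - α x) * (1 - B x) else 0
    with hw'
  have hB0 : ∀ x, 0 ≤ B x := fun x => by rcases hB x with h | h <;> simp [h]
  have hB1 : ∀ x, B x ≤ 1 := fun x => by rcases hB x with h | h <;> simp [h]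
  have hαt : ∀ x y, α (update x t y) = α x := fun x y => by simp [hα]
  have hwt : ∀ x y, w (update x t y) = w x := fun x y => hw.update_eq x t ht y
  have hnn : ∀ x, 0 ≤ w' x := fun x => by
    simp only [hw']
    split_ifs with h
    · exact mul_nonneg (div_nonneg (hw.nonneg x) (by linarith)) (by linarith [hB1 x])
    · exact le_rfl
  have hle : ∀ x, w' x ≤ 2 * w x := fun x => by
    simp only [hw']
    split_ifs with h
    · have h1 : w x / (1 - α x) ≤ 2 * w x := by
        rw [div_le_iff₀ (by linarith)]
        nlinarith [hw.nonneg x]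
      calc _ ≤ w x / (1 - α x) * 1 :=
            mul_le_mul_of_nonneg_left (by linarith [hB0 x])
              (div_nonneg (hw.nonneg x) (by linarith))
        _ ≤ _ := by linarith
    · linarith [hw.nonneg x]
  -- On a kept fibre `1 - B` has mean `1 - α`, which the normalisation cancels: averages not
  -- involving coordinate `t` never increase.
  have hfib : ∀ x, 𝔼 y, w' (update x t y) = if α x ≤ 1 / 2 then w x else 0 := fun x => by
    simp only [hw', hαt, hwt]
    split_ifs with h
    · rw [← Finset.mul_expect, Finset.expect_sub_distrib, Fintype.expect_const]
      exact div_mul_cancel₀ _ (by linarith)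
    · simp
  refine ⟨w', ⟨hnn, ?_, ?_⟩, ?_, ?_⟩
  · intro x i hi y
    have hit : i ≠ t := fun h => hi (h ▸ mem_insert_self _ _)
    have h1 : α (update x i y) = α x := by
      simp only [hα]
      refine Finset.expect_congr rfl fun z _ => ?_
      rw [update_comm hit, hBU _ i hi]
    simp only [hw', h1, hBU x i hi, hw.update_eq x i (fun h => hi (mem_insert_of_mem h))]
  · intro τ hτ V hV
    have hP : ∀ W : Finset ι, ∀ x : ∀ i, X i, 0 ≤ ∏ i ∈ W, τ i (x i) :=
      fun W x => prod_nonneg fun i _ => hτ _ _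
    -- The crude bound `w' ≤ 2 * w` is used only when `t ∈ V`, where the factor 2 is allowed;
    -- otherwise `hfib` gives the bound with no loss.
    by_cases htV : t ∈ V
    · have hsub : V.erase t ⊆ U := fun i hi => by
        rw [mem_erase] at hi
        exact (mem_insert.1 (hV hi.2)).resolve_left hi.1
      rw [← mul_prod_erase V _ htV]
      have hupd : ∀ (x : ∀ i, X i) y,
          ∏ i ∈ V.erase t, τ i (update x t y i) = ∏ i ∈ V.erase t, τ i (x i) := fun x y =>
        prod_congr rfl fun i hi => by rw [update_of_ne (ne_of_mem_erase hi)]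
      calc 𝔼 x, w' x * ∏ i ∈ V, τ i (x i)
          ≤ 𝔼 x, 2 * w x * ∏ i ∈ V, τ i (x i) :=
            expect_le_expect fun x _ => mul_le_mul_of_nonneg_right (hle x) (hP V x)
        _ = 𝔼 x, (2 * 𝔼 y, τ t y) * (w x * ∏ i ∈ V.erase t, τ i (x i)) := by
            rw [expect_pi_eq_expect_expect_update t]
            refine Finset.expect_congr rfl fun x _ => ?_
            simp only [hwt, ← mul_prod_erase V _ htV, hupd, update_self]
            rw [← Finset.mul_expect, ← Finset.expect_mul]
            ring
        _ = (2 * 𝔼 y, τ t y) * 𝔼 x, w x * ∏ i ∈ V.erase t, τ i (x i) :=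
            (Finset.mul_expect _ _ _).symm
        _ ≤ _ := mul_le_mul_of_nonneg_left (hw.expect_le τ hτ _ hsub)
            (mul_nonneg zero_le_two (expect_nonneg fun y _ => hτ t y))
    · have hsub : V ⊆ U := fun i hi =>
        (mem_insert.1 (hV hi)).resolve_left fun h => htV (h ▸ hi)
      refine le_trans ?_ (hw.expect_le τ hτ V hsub)
      rw [expect_pi_eq_expect_expect_update t]
      refine expect_le_expect fun x _ => ?_
      have hupd : ∀ y, ∏ i ∈ V, τ i (update x t y i) = ∏ i ∈ V, τ i (x i) := fun y =>
        prod_congr rfl fun i hi => by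
          rw [update_of_ne (ne_of_mem_of_not_mem hi htV)]
      simp only [hupd]
      rw [← Finset.expect_mul, hfib]
      refine mul_le_mul_of_nonneg_right ?_ (hP V x)
      split_ifs
      · exact le_rfl
      · exact hw.nonneg x
  · rintro x (h | h) <;> simp [hw', h]
  · rw [expect_pi_eq_expect_expect_update t w', Finset.mul_expect, ← Finset.expect_sub_distrib]
    refine expect_le_expect fun x _ => ?_
    rw [hfib]
    change w x - 4 * (w x * α x ^ 2) ≤ _
    -- Only dropped fibres lose mass, and there `α > 1/2` makes `4 * α ^ 2` at least 1.
    split_ifs with h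
    · nlinarith [mul_nonneg (hw.nonneg x) (sq_nonneg (α x))]
    · have : 1 ≤ 4 * α x ^ 2 := by nlinarith
      nlinarith [hw.nonneg x]

/-! ### The second moment of the covered proportion -/

/-- The contribution of the exponents `a, b` of one prime to the second moment. -/
noncomputable def pairWeight (r : ℝ) (p : ℕ × ℕ) : ℝ :=
  if p.1 = 0 ∧ p.2 = 0 then 1 else 2 * r ^ max p.1 p.2

lemma pairWeight_nonneg {r : ℝ} (hr : 0 ≤ r) (p : ℕ × ℕ) : 0 ≤ pairWeight r p := by
  unfold pairWeight
  split_ifs <;> positivity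

/-- The total contribution of a prime of norm `N` to the second moment, apart from the trivial
pair of exponents. -/
noncomputable def momentFactor (N : ℝ) : ℝ := 2 * (3 * N - 1) / (N - 1) ^ 2

lemma momentFactor_nonneg {N : ℝ} (hN : 1 < N) : 0 ≤ momentFactor N :=
  div_nonneg (by linarith) (sq_nonneg _)

/-- There are `2 * m + 1` pairs of exponents with maximum `m`, and `∑ (2 * m + 1) * r ^ m` over `m ≥
1` is `(3 * r - r ^ 2) / (1 - r) ^ 2`. The term subtracted in `key` is the tail of this series. -/
lemma sum_pairWeight_le {N : ℝ} (hN : 1 < N) (M : ℕ) :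
    ∑ p ∈ range M ×ˢ range M, pairWeight N⁻¹ p ≤ 1 + momentFactor N := by
  set r := N⁻¹ with hr
  have hr0 : 0 < r := inv_pos.2 (by linarith)
  have hr1 : r < 1 := inv_lt_one_of_one_lt₀ hN
  have hNr : N = r⁻¹ := by rw [hr, inv_inv]
  have hne : 1 - r ≠ 0 := by linarith
  have hfac : momentFactor N = 2 * ((3 * r - r ^ 2) / (1 - r) ^ 2) := by
    rw [momentFactor, hNr]
    have : r⁻¹ - 1 ≠ 0 := by rw [← hNr]; linarith
    field_simp
  have key : ∀ M : ℕ, ∑ p ∈ range (M + 1) ×ˢ range (M + 1), pairWeight r p =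
      1 + 2 * ((3 * r - r ^ 2) / (1 - r) ^ 2 -
        r ^ (M + 1) * ((2 * M + 3) / (1 - r) + 2 * r / (1 - r) ^ 2)) := by
    intro M
    induction M with
    | zero =>
      simp [pairWeight]
      field_simp
      ring
    | succ M ih =>
      rw [sum_product] at ih ⊢
      rw [sum_range_succ, sum_congr rfl fun a _ => sum_range_succ _ _, sum_add_distrib, ih]
      have h1 : ∀ a ∈ range (M + 1), pairWeight r (a, M + 1) = 2 * r ^ (M + 1) := fun a ha => by
        rw [mem_range] at ha
        simp [pairWeight, max_eq_right ha.le]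
      have h2 : ∀ a ∈ range (M + 1), pairWeight r (M + 1, a) = 2 * r ^ (M + 1) := fun a ha => by
        rw [mem_range] at ha
        simp [pairWeight, max_eq_left ha.le]
      rw [sum_congr rfl h1, sum_range_succ (fun a => pairWeight r (M + 1, a)), sum_congr rfl h2]
      simp [pairWeight]
      field_simp
      ring
  cases M with
  | zero => simpa using add_nonneg zero_le_one (momentFactor_nonneg hN)
  | succ M =>
    rw [key, hfac]
    have h3 : 0 < 1 - r := by linarith
    have : 0 ≤ r ^ (M + 1) * ((2 * M + 3) / (1 - r) + 2 * r / (1 - r) ^ 2) := by positivity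
    linarith

lemma sum_Ico_inv_pow_le {N : ℝ} (hN : 1 < N) (M : ℕ) :
    ∑ a ∈ Ico 1 M, N⁻¹ ^ a ≤ (N - 1)⁻¹ := by
  have h0 : 0 < N - 1 := by linarith
  have hN0 : 0 < N := by linarith
  have key : ∀ M : ℕ, ∑ a ∈ Ico 1 (M + 1), N⁻¹ ^ a = (N - 1)⁻¹ - N⁻¹ ^ M * (N - 1)⁻¹ := by
    intro M
    induction M with
    | zero => simp
    | succ M ih =>
      rw [sum_Ico_succ_top (by omega), ih, pow_succ]
      field_simp
      ring
  cases M with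
  | zero => simpa using h0.le
  | succ M =>
    rw [key]
    have : 0 ≤ N⁻¹ ^ M * (N - 1)⁻¹ := by positivity
    linarith

/-- A sum over pairs of indices, of a function of their exponent vectors, is at most `s ^ 2` times
the sum over all pairs of exponent vectors when each exponent vector occurs at most `s` times. -/
lemma sum_sum_le_sq_mul_prod_sum {κ : Type*} [Fintype κ] (v : κ → ι → ℕ) {s M : ℕ}
    (hM : ∀ k i, v k i < M) (hs : ∀ a, Nat.card {k // v k = a} ≤ s) (φ : ι → ℕ × ℕ → ℝ)
    (hφ : ∀ i p, 0 ≤ φ i p) :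
    ∑ k, ∑ l, ∏ i, φ i (v k i, v l i) ≤
      (s : ℝ) ^ 2 * ∏ i, ∑ p ∈ range M ×ˢ range M, φ i p := by
  classical
  rw [prod_univ_sum, mul_sum, ← sum_product', univ_product_univ]
  have hmaps : ∀ p ∈ (univ : Finset (κ × κ)), (fun i => (v p.1 i, v p.2 i)) ∈
      Fintype.piFinset fun _ : ι => range M ×ˢ range M := fun p _ => by
    simp [Fintype.mem_piFinset, hM]
  rw [← sum_fiberwise_of_maps_to hmaps]
  refine sum_le_sum fun a _ => ?_
  have h1 : ∀ p ∈ ({p ∈ univ | (fun i => (v p.1 i, v p.2 i)) = a} : Finset (κ × κ)),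
      ∏ i, φ i (v p.1 i, v p.2 i) = ∏ i, φ i (a i) := fun p hp => by
    rw [mem_filter] at hp
    exact prod_congr rfl fun i _ => by rw [← hp.2]
  rw [sum_congr rfl h1, sum_const, nsmul_eq_mul]
  refine mul_le_mul_of_nonneg_right ?_ (prod_nonneg fun i _ => hφ _ _)
  have hcard : ∀ b, #{k | v k = b} ≤ s := fun b => by
    rw [← Fintype.card_subtype, ← Nat.card_eq_fintype_card]
    exact hs b
  have h2 : ({p ∈ univ | (fun i => (v p.1 i, v p.2 i)) = a} : Finset (κ × κ)) ⊆
      ({k | v k = fun i => (a i).1} : Finset κ) ×ˢ ({k | v k = fun i => (a i).2} : Finset κ) := by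
    intro p hp
    rw [mem_filter] at hp
    simp [← hp.2]
  have h3 := (card_le_card h2).trans_eq (card_product _ _)
  have h4 := h3.trans (Nat.mul_le_mul (hcard _) (hcard _))
  rw [sq]
  exact_mod_cast h4

variable {κ : Type*} [Fintype κ] {v : κ → ι → ℕ} {S : κ → ∀ i, Set (X i)} {N : ι → ℝ}

/-- The second moment bound: under a spread weight, the square of the density of the boxes which
involve `t` and otherwise only coordinates in `U`. -/
lemma IsSpreadWeight.expect_sq_le [∀ i, Nonempty (X i)] {U : Finset ι} {w : (∀ i, X i) → ℝ}
    (hw : IsSpreadWeight U w) {t : ι} (ht : t ∉ U) (hN : ∀ i, 1 < N i)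
    (hS0 : ∀ k i, v k i = 0 → S k i = Set.univ)
    (hS : ∀ k i, 𝔼 y, (S k i).indicator (1 : X i → ℝ) y ≤ (N i)⁻¹ ^ v k i)
    {s : ℕ} (hs : ∀ a, Nat.card {k // v k = a} ≤ s) (K : Finset κ)
    (hK : ∀ k ∈ K, v k t ≠ 0 ∧ ∀ i, v k i ≠ 0 → i ∈ insert t U) :
    𝔼 x, w x * (∑ k ∈ K, (∏ i ∈ U, (S k i).indicator (1 : X i → ℝ) (x i)) *
      (N t)⁻¹ ^ v k t) ^ 2 ≤
      (s : ℝ) ^ 2 * ((N t - 1)⁻¹ ^ 2 * ∏ i ∈ U, (1 + momentFactor (N i))) := by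
  have hr0 : ∀ i, 0 ≤ (N i)⁻¹ := fun i => inv_nonneg.2 (by linarith [hN i])
  set σ : κ → ∀ i, X i → ℝ := fun k i => (S k i).indicator 1 with hσ
  have hσ0 : ∀ k i y, 0 ≤ σ k i y := fun k i y => Set.indicator_nonneg (fun _ _ => zero_le_one) y
  have hσ1 : ∀ k i y, σ k i y ≤ 1 := fun k i y =>
    Set.indicator_le_self' (fun _ _ => zero_le_one) y
  have hσe : ∀ k i y, v k i = 0 → σ k i y = 1 := fun k i y h => by simp [hσ, hS0 k i h]
  -- Coordinates where both exponents vanish are left out of the product, so that they cost 1 rather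
  -- than 2. Elsewhere the intersection is bounded by the side with the larger exponent.
  have hpair : ∀ k l, 𝔼 x, w x * ∏ i ∈ U, (σ k i (x i) * σ l i (x i)) ≤
      ∏ i ∈ U, pairWeight (N i)⁻¹ (v k i, v l i) := by
    intro k l
    have h1 := hw.expect_le (fun i y => σ k i y * σ l i y)
      (fun i y => mul_nonneg (hσ0 _ _ _) (hσ0 _ _ _)) (U.filter fun i => ¬(v k i = 0 ∧ v l i = 0))
      (filter_subset _ _)
    have h2 : ∀ x : ∀ i, X i, ∏ i ∈ U with ¬(v k i = 0 ∧ v l i = 0), (σ k i (x i) * σ l i (x i)) =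
        ∏ i ∈ U, (σ k i (x i) * σ l i (x i)) := fun x => by
      rw [prod_filter]
      refine prod_congr rfl fun i _ => ?_
      split_ifs with h
      · rw [hσe k i _ h.1, hσe l i _ h.2, one_mul]
      · rfl
    simp only [h2] at h1
    refine h1.trans ?_
    rw [prod_filter]
    refine prod_le_prod (fun i _ => ?_) fun i _ => ?_
    · split_ifs
      · exact zero_le_one
      · exact mul_nonneg zero_le_two (expect_nonneg fun y _ => mul_nonneg (hσ0 _ _ _) (hσ0 _ _ _))
    · unfold pairWeight
      by_cases h : v k i = 0 ∧ v l i = 0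
      · simp [h]
      · simp only [h, not_false_eq_true, if_true, if_false]
        refine mul_le_mul_of_nonneg_left ?_ zero_le_two
        rcases le_total (v k i) (v l i) with h' | h'
        · rw [max_eq_right h']
          exact (expect_le_expect fun y _ => mul_le_of_le_one_left (hσ0 _ _ _) (hσ1 _ _ _)).trans
            (hS l i)
        · rw [max_eq_left h']
          exact (expect_le_expect fun y _ => mul_le_of_le_one_right (hσ0 _ _ _) (hσ1 _ _ _)).trans
            (hS k i)
  -- The membership conditions of `K` are encoded coordinatewise: exponents at `t` must be nonzero,
  -- those outside `insert t U` must vanish. The sum over `K` can then be extended to all pairs and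
  -- factorised.
  set φ : ι → ℕ × ℕ → ℝ := fun i p =>
    if i ∈ U then pairWeight (N i)⁻¹ p else
      if i = t then (if p.1 = 0 ∨ p.2 = 0 then 0 else (N i)⁻¹ ^ p.1 * (N i)⁻¹ ^ p.2)
      else if p.1 = 0 ∧ p.2 = 0 then 1 else 0 with hφ
  have hφ0 : ∀ i p, 0 ≤ φ i p := fun i p => by
    simp only [hφ]
    split_ifs
    · exact pairWeight_nonneg (hr0 i) p
    · exact le_rfl
    · exact mul_nonneg (pow_nonneg (hr0 i) _) (pow_nonneg (hr0 i) _)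
    · exact zero_le_one
    · exact le_rfl
  have hsplit : ∀ f : ι → ℝ, (∀ i ∉ insert t U, f i = 1) → ∏ i, f i = f t * ∏ i ∈ U, f i :=
    fun f hf => by
      rw [← prod_insert ht]
      exact (prod_subset (subset_univ _) fun i _ hi => hf i hi).symm
  have hφK : ∀ k ∈ K, ∀ l ∈ K, ∏ i, φ i (v k i, v l i) =
      (N t)⁻¹ ^ v k t * (N t)⁻¹ ^ v l t * ∏ i ∈ U, pairWeight (N i)⁻¹ (v k i, v l i) := by
    intro k hk l hl
    rw [hsplit]
    · congr 1
      · simp [hφ, ht, (hK k hk).1, (hK l hl).1]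
      · exact prod_congr rfl fun i hi => by simp [hφ, hi]
    · intro i hi
      have h1 : v k i = 0 := by_contra fun h => hi ((hK k hk).2 i h)
      have h2 : v l i = 0 := by_contra fun h => hi ((hK l hl).2 i h)
      rw [mem_insert, not_or] at hi
      simp [hφ, hi.1, hi.2, h1, h2]
  obtain ⟨M, hM⟩ : ∃ M, ∀ k i, v k i < M := by
    refine ⟨∑ k, ∑ i, v k i + 1, fun k i => Nat.lt_succ_of_le ?_⟩
    exact (single_le_sum (f := fun i => v k i) (fun _ _ => Nat.zero_le _) (mem_univ i)).trans
      (single_le_sum (f := fun k => ∑ i, v k i) (fun _ _ => Nat.zero_le _) (mem_univ k))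
  calc _ = ∑ k ∈ K, ∑ l ∈ K, (N t)⁻¹ ^ v k t * (N t)⁻¹ ^ v l t *
        𝔼 x, w x * ∏ i ∈ U, (σ k i (x i) * σ l i (x i)) := by
        simp only [Finset.mul_expect, ← Finset.expect_sum_comm]
        refine Finset.expect_congr rfl fun x _ => ?_
        rw [sq, sum_mul_sum, mul_sum]
        refine sum_congr rfl fun k _ => ?_
        rw [mul_sum]
        refine sum_congr rfl fun l _ => ?_
        rw [prod_mul_distrib]
        ring
    _ ≤ ∑ k ∈ K, ∑ l ∈ K, ∏ i, φ i (v k i, v l i) := by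
        refine sum_le_sum fun k hk => sum_le_sum fun l hl => ?_
        rw [hφK k hk l hl]
        exact mul_le_mul_of_nonneg_left (hpair k l)
          (mul_nonneg (pow_nonneg (hr0 t) _) (pow_nonneg (hr0 t) _))
    _ ≤ ∑ k, ∑ l, ∏ i, φ i (v k i, v l i) :=
        (sum_le_sum fun k _ => sum_le_sum_of_subset_of_nonneg (subset_univ _)
          fun l _ _ => prod_nonneg fun i _ => hφ0 _ _).trans
        (sum_le_sum_of_subset_of_nonneg (subset_univ _)
          fun k _ _ => sum_nonneg fun l _ => prod_nonneg fun i _ => hφ0 _ _)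
    _ ≤ (s : ℝ) ^ 2 * ∏ i, ∑ p ∈ range M ×ˢ range M, φ i p :=
        sum_sum_le_sq_mul_prod_sum v hM hs φ hφ0
    _ ≤ (s : ℝ) ^ 2 * ∏ i, (if i ∈ U then 1 + momentFactor (N i) else
          if i = t then (N t - 1)⁻¹ ^ 2 else 1) := by
        refine mul_le_mul_of_nonneg_left (prod_le_prod
          (fun i _ => sum_nonneg fun p _ => hφ0 _ _) fun i _ => ?_) (sq_nonneg _)
        by_cases hiU : i ∈ U
        · simp only [hφ, hiU, if_true]
          exact sum_pairWeight_le (hN i) M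
        · by_cases hit : i = t
          · subst hit
            simp only [hφ, ht, if_true, if_false]
            have h0 : 0 ≤ ∑ a ∈ Ico 1 M, (N i)⁻¹ ^ a := sum_nonneg fun a _ => pow_nonneg (hr0 i) _
            refine le_trans (le_of_eq ?_) (pow_le_pow_left₀ h0 (sum_Ico_inv_pow_le (hN i) M) 2)
            rw [sq, sum_mul_sum, ← sum_product']
            symm
            refine sum_subset_zero_on_sdiff ?_ ?_ ?_
            · intro p hp
              simp only [mem_product, mem_Ico, mem_range] at hp ⊢
              omega
            · intro p hp
              simp only [mem_sdiff, mem_product, mem_Ico, mem_range] at hp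
              rw [if_pos (by omega)]
            · intro p hp
              simp only [mem_product, mem_Ico] at hp
              rw [if_neg (by omega)]
          · simp only [hφ, hiU, hit, if_false]
            rw [sum_ite, sum_const_zero, add_zero, sum_const, nsmul_eq_mul, mul_one]
            have : #{p ∈ range M ×ˢ range M | p.1 = 0 ∧ p.2 = 0} ≤ #{((0 : ℕ), (0 : ℕ))} := by
              refine card_le_card fun p hp => ?_
              rw [mem_filter] at hp
              simp [Prod.ext_iff, hp.2]
            exact_mod_cast this
    _ = _ := by
        rw [hsplit]
        · simp only [ht, if_true, if_false]
          congr 2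
          exact prod_congr rfl fun i hi => by simp [hi]
        · intro i hi
          rw [mem_insert, not_or] at hi
          simp [hi.1, hi.2]

/-! ### Iterating over the coordinates -/

/-- A weight of large average, supported off all boxes which only involve coordinates in `U`. -/
lemma exists_isSpreadWeight {ι : Type*} [Fintype ι] [LinearOrder ι] {X : ι → Type*}
    [∀ i, Fintype (X i)] [∀ i, Nonempty (X i)] {κ : Type*} [Fintype κ] {v : κ → ι → ℕ}
    {S : κ → ∀ i, Set (X i)} {N : ι → ℝ} (hN : ∀ i, 1 < N i) (hv : ∀ k, v k ≠ 0)
    (hS0 : ∀ k i, v k i = 0 → S k i = Set.univ)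
    (hS : ∀ k i, 𝔼 y, (S k i).indicator (1 : X i → ℝ) y ≤ (N i)⁻¹ ^ v k i)
    {s : ℕ} (hs : ∀ a, Nat.card {k // v k = a} ≤ s) (U : Finset ι) :
    ∃ w : (∀ i, X i) → ℝ, IsSpreadWeight U w ∧
      (∀ k, (∀ i, v k i ≠ 0 → i ∈ U) → ∀ x, (∀ i, x i ∈ S k i) → w x = 0) ∧
      1 - ∑ i ∈ U, 4 * ((s : ℝ) ^ 2 * ((N i - 1)⁻¹ ^ 2 *
        ∏ j ∈ U with j < i, (1 + momentFactor (N j)))) ≤ 𝔼 x, w x := by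
  classical
  induction U using Finset.induction_on_max with
  | empty =>
    refine ⟨fun _ => 1, isSpreadWeight_one, fun k hk => ?_, by simp⟩
    -- A box involving no coordinate would be the whole product; `hv` excludes it.
    exact absurd (funext fun i => by_contra fun h => by simpa using hk i h) (hv k)
  | insert t U htU ih =>
    obtain ⟨w, hw, hw0, hwE⟩ := ih
    have ht : t ∉ U := fun h => (htU t h).false
    set K : Finset κ := {k | v k t ≠ 0 ∧ ∀ i, v k i ≠ 0 → i ∈ insert t U} with hK
    have hKm : ∀ k, k ∈ K ↔ v k t ≠ 0 ∧ ∀ i, v k i ≠ 0 → i ∈ insert t U := fun k => by simp [hK]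
    set B : (∀ i, X i) → ℝ := fun x => if ∃ k ∈ K, ∀ i, x i ∈ S k i then 1 else 0 with hB
    have hBU : ∀ x, ∀ i ∉ insert t U, ∀ y, B (update x i y) = B x := by
      intro x i hi y
      have : (∃ k ∈ K, ∀ j, update x i y j ∈ S k j) ↔ ∃ k ∈ K, ∀ j, x j ∈ S k j := by
        refine exists_congr fun k => and_congr_right fun hk => forall_congr' fun j => ?_
        by_cases hj : j = i
        · subst hj
          have : v k j = 0 := by_contra fun h => hi (((hKm k).1 hk).2 j h)
          simp [hS0 k j this]
        · rw [update_of_ne hj]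
      simp only [hB, this]
    obtain ⟨w', hw', hw0', hwE'⟩ := hw.exists_insert ht B
      (fun x => by simp only [hB]; split_ifs <;> simp) hBU
    refine ⟨w', hw', fun k hk x hx => hw0' x ?_, ?_⟩
    · by_cases hkt : v k t = 0
      · refine Or.inl (hw0 k (fun i hi => ?_) x hx)
        exact (mem_insert.1 (hk i hi)).resolve_left fun h => hi (h ▸ hkt)
      · exact Or.inr (if_pos ⟨k, (hKm k).2 ⟨hkt, hk⟩, hx⟩)
    · have hind : ∀ k i y, 0 ≤ (S k i).indicator (1 : X i → ℝ) y := fun k i y =>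
        Set.indicator_nonneg (fun _ _ => zero_le_one) y
      have hr0 : 0 ≤ (N t)⁻¹ := inv_nonneg.2 (by linarith [hN t])
      -- Union bound within the fibre.
      have hα : ∀ x, 𝔼 y, B (update x t y) ≤
          ∑ k ∈ K, (∏ i ∈ U, (S k i).indicator (1 : X i → ℝ) (x i)) * (N t)⁻¹ ^ v k t := by
        intro x
        calc 𝔼 y, B (update x t y)
            ≤ 𝔼 y, ∑ k ∈ K, (∏ i ∈ U, (S k i).indicator (1 : X i → ℝ) (x i)) *
                (S k t).indicator (1 : X t → ℝ) y := by
              refine expect_le_expect fun y _ => ?_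
              have hnn : ∀ k ∈ K, 0 ≤ (∏ i ∈ U, (S k i).indicator (1 : X i → ℝ) (x i)) *
                (S k t).indicator (1 : X t → ℝ) y := fun k _ =>
                  mul_nonneg (prod_nonneg fun i _ => hind _ _ _) (hind _ _ _)
              simp only [hB]
              split_ifs with h
              · obtain ⟨k, hk, hx⟩ := h
                refine le_trans (le_of_eq ?_) (single_le_sum hnn hk)
                have h1 : y ∈ S k t := by simpa using hx t
                rw [Set.indicator_of_mem h1, prod_eq_one fun i hi => ?_]
                · simp
                · have h2 := hx i
                  rw [update_of_ne (ne_of_mem_of_not_mem hi ht)] at h2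
                  simp [h2]
              · exact sum_nonneg hnn
          _ = ∑ k ∈ K, (∏ i ∈ U, (S k i).indicator (1 : X i → ℝ) (x i)) *
                𝔼 y, (S k t).indicator (1 : X t → ℝ) y := by
              simp only [Finset.expect_sum_comm, Finset.mul_expect]
          _ ≤ _ := sum_le_sum fun k _ =>
              mul_le_mul_of_nonneg_left (hS k t) (prod_nonneg fun i _ => hind _ _ _)
      have hα0 : ∀ x, 0 ≤ 𝔼 y, B (update x t y) := fun x => expect_nonneg fun y _ => by
        simp only [hB]; split_ifs <;> simp
      have hm := hw.expect_sq_le ht hN hS0 hS hs K fun k hk => (hKm k).1 hk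
      have hm' := (expect_le_expect fun x _ => mul_le_mul_of_nonneg_left
        (pow_le_pow_left₀ (hα0 x) (hα x) 2) (hw.nonneg x)).trans hm
      have h1 : (insert t U).filter (· < t) = U := by
        rw [filter_insert, if_neg (lt_irrefl t)]
        exact filter_true_of_mem htU
      have h2 : ∀ i ∈ U, (insert t U).filter (· < i) = U.filter (· < i) := fun i hi => by
        rw [filter_insert, if_neg (htU i hi).le.not_gt]
      rw [sum_insert ht, h1, sum_congr rfl fun i hi => by rw [h2 i hi]]
      linarith

/-- **Distortion sieve.** Boxes in a finite product, whose densities decay with their exponent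
vectors and whose exponent vectors repeat at most `s` times, do not cover the product when the sum
of the second moment bounds is small. -/
theorem exists_forall_exists_notMem_of_sum_lt_one {ι : Type*} [Fintype ι] [LinearOrder ι]
    {X : ι → Type*} [∀ i, Fintype (X i)] [∀ i, Nonempty (X i)] {κ : Type*} [Fintype κ]
    {v : κ → ι → ℕ} {S : κ → ∀ i, Set (X i)} {N : ι → ℝ} (hN : ∀ i, 1 < N i) (hv : ∀ k, v k ≠ 0)
    (hS0 : ∀ k i, v k i = 0 → S k i = Set.univ)
    (hS : ∀ k i, 𝔼 y, (S k i).indicator (1 : X i → ℝ) y ≤ (N i)⁻¹ ^ v k i)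
    {s : ℕ} (hs : ∀ a, Nat.card {k // v k = a} ≤ s)
    (hsum : ∑ i, 4 * ((s : ℝ) ^ 2 * ((N i - 1)⁻¹ ^ 2 *
      ∏ j with j < i, (1 + momentFactor (N j)))) < 1) :
    ∃ x : ∀ i, X i, ∀ k, ∃ i, x i ∉ S k i := by
  obtain ⟨w, -, hw0, hwE⟩ := exists_isSpreadWeight hN hv hS0 hS hs univ
  by_contra! h
  have : 𝔼 x, w x = 0 := Finset.expect_eq_zero fun x _ => by
    obtain ⟨k, hk⟩ := h x
    exact hw0 k (fun i _ => mem_univ i) x hk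
  linarith

end Sieve

/-! ### Numerical estimate of the total loss -/

section Numerics

open Finset Function
open scoped BigOperators

/-- The product tends to 6 as `N` grows; 0.02 is slack. -/
lemma mul_momentFactor_le {N : ℝ} (hN : 759 ≤ N) : N * momentFactor N ≤ 6.02 := by
  have h : 0 < (N - 1) ^ 2 := by nlinarith
  rw [momentFactor, ← mul_div_assoc, div_le_iff₀ h]
  nlinarith

lemma exp_le_four_hundred_twenty : Real.exp 6.02 ≤ 420 := by
  have h1 : Real.exp 6.02 = Real.exp 1 ^ 6 * Real.exp 0.02 := by
    rw [← Real.exp_nat_mul, ← Real.exp_add]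
    norm_num
  have h2 : Real.exp 1 ^ 6 ≤ 2.7182818286 ^ 6 :=
    pow_le_pow_left₀ (Real.exp_pos 1).le Real.exp_one_lt_d9.le 6
  have h3 : Real.exp 0.02 ≤ 1 / (1 - 0.02) := by
    have := Real.add_one_le_exp (-0.02 : ℝ)
    rw [Real.exp_neg] at this
    rw [le_div_iff₀ (by norm_num)]
    have h4 := mul_le_mul_of_nonneg_left this (Real.exp_pos 0.02).le
    rw [mul_inv_cancel₀ (Real.exp_pos _).ne'] at h4
    linarith
  rw [h1]
  calc _ ≤ (2.7182818286 : ℝ) ^ 6 * (1 / (1 - 0.02)) := by gcongr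
    _ ≤ 420 := by norm_num

variable {ι : Type*} [Fintype ι]

/-- Since `1 + g ≤ exp g`, the at most `q ^ l` primes of degree `l` together contribute at most `exp
6.02 ≤ 420`, independently of `l`. -/
lemma prod_one_add_momentFactor_le {q : ℕ} (hq : 759 ≤ q) {d : ι → ℕ} (hd : ∀ i, 1 ≤ d i)
    (hcard : ∀ l, #{i | d i = l} ≤ q ^ l) (m : ℕ) :
    ∏ i with d i ≤ m, (1 + momentFactor ((q : ℝ) ^ d i)) ≤ 420 ^ m := by
  classical
  have hq' : (759 : ℝ) ≤ q := by exact_mod_cast hq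
  have hN : ∀ l, 1 ≤ l → (759 : ℝ) ≤ (q : ℝ) ^ l := fun l hl =>
    hq'.trans (le_self_pow₀ (by linarith) (by omega))
  have hg : ∀ l, 1 ≤ l → 0 ≤ momentFactor ((q : ℝ) ^ l) := fun l hl =>
    momentFactor_nonneg (by linarith [hN l hl])
  induction m with
  | zero =>
    rw [filter_false_of_mem fun i _ => by have := hd i; omega]
    simp
  | succ m ih =>
    have h1 : (univ.filter fun i => d i ≤ m + 1) =
        (univ.filter fun i => d i ≤ m) ∪ univ.filter fun i => d i = m + 1 := by
      ext i
      simp only [mem_filter, mem_union, mem_univ, true_and]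
      omega
    have h2 : Disjoint (univ.filter fun i => d i ≤ m) (univ.filter fun i => d i = m + 1) :=
      disjoint_filter.2 fun i _ h => by omega
    rw [h1, prod_union h2, pow_succ]
    have h3 : ∏ i with d i = m + 1, (1 + momentFactor ((q : ℝ) ^ d i)) ≤ 420 := by
      calc _ = (1 + momentFactor ((q : ℝ) ^ (m + 1))) ^ #{i | d i = m + 1} := by
            rw [← prod_const]
            exact prod_congr rfl fun i hi => by rw [(mem_filter.1 hi).2]
        _ ≤ Real.exp (momentFactor ((q : ℝ) ^ (m + 1))) ^ #{i | d i = m + 1} := by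
            refine pow_le_pow_left₀ (by linarith [hg (m + 1) (by omega)]) ?_ _
            linarith [Real.add_one_le_exp (momentFactor ((q : ℝ) ^ (m + 1)))]
        _ = Real.exp (#{i | d i = m + 1} * momentFactor ((q : ℝ) ^ (m + 1))) := by
            rw [← Real.exp_nat_mul]
        _ ≤ Real.exp 6.02 := by
            refine Real.exp_le_exp.2 ((mul_le_mul_of_nonneg_right ?_ (hg (m + 1) (by omega))).trans
              (mul_momentFactor_le (hN (m + 1) (by omega))))
            exact_mod_cast hcard (m + 1)
        _ ≤ 420 := exp_le_four_hundred_twenty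
    refine mul_le_mul ih h3 (prod_nonneg fun i _ => ?_) (by positivity)
    linarith [hg (d i) (hd i)]

/-- The moment condition of the sieve holds for at most `q ^ l` primes of norm `q ^ l` each,
ordered by their norms, as soon as `759 * s ^ 2 ≤ q`. -/
lemma sum_moment_lt_one [LinearOrder ι] {q s : ℕ} (hs : 1 ≤ s) (hq : 759 * s ^ 2 ≤ q) {d : ι → ℕ}
    (hd : ∀ i, 1 ≤ d i) (hmono : Monotone d) (hcard : ∀ l, #{i | d i = l} ≤ q ^ l) :
    ∑ i, 4 * ((s : ℝ) ^ 2 * ((((q : ℝ) ^ d i) - 1)⁻¹ ^ 2 *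
      ∏ j with j < i, (1 + momentFactor ((q : ℝ) ^ d j)))) < 1 := by
  have hq1 : 759 ≤ q := le_trans (by nlinarith) hq
  have hq' : (759 : ℝ) ≤ q := by exact_mod_cast hq1
  have hN : ∀ l, 1 ≤ l → (759 : ℝ) ≤ (q : ℝ) ^ l := fun l hl =>
    hq'.trans (le_self_pow₀ (by linarith) (by omega))
  set g : ι → ℝ := fun i => momentFactor ((q : ℝ) ^ d i) with hg
  have hg0 : ∀ i, 0 ≤ g i := fun i => momentFactor_nonneg (by linarith [hN _ (hd i)])
  have hprod : ∀ T : Finset ι, 0 ≤ ∏ j ∈ T, (1 + g j) := fun T =>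
    prod_nonneg fun j _ => by linarith [hg0 j]
  -- One factor `q` absorbs `s ^ 2`, the others need only `759 ≤ q`; 0.67 exceeds 2/3 by enough to
  -- absorb the `- 1`.
  have hc : ∀ l, 1 ≤ l → 2 * (s : ℝ) ^ 2 / (3 * (q : ℝ) ^ l - 1) ≤ 0.67 * (759⁻¹ : ℝ) ^ l := by
    intro l hl
    have h1 := hN l hl
    have h2 : (s : ℝ) ^ 2 * 759 ^ l ≤ (q : ℝ) ^ l := by
      obtain ⟨m, rfl⟩ := Nat.exists_eq_add_of_le' hl
      have h3 : (s : ℝ) ^ 2 * 759 ≤ q := by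
        rw [mul_comm]
        exact_mod_cast hq
      calc (s : ℝ) ^ 2 * 759 ^ (m + 1) = 759 ^ m * ((s : ℝ) ^ 2 * 759) := by ring
        _ ≤ (q : ℝ) ^ m * q := by gcongr
        _ = _ := by ring
    have h759 : (0 : ℝ) < 759 ^ l := by positivity
    rw [div_le_iff₀ (by linarith), inv_pow, mul_assoc, mul_comm (_⁻¹), ← div_eq_mul_inv,
      ← mul_div_assoc, le_div_iff₀ h759]
    nlinarith
  -- Extracting `g i` from `(N - 1)⁻¹ ^ 2` prepares a telescoping sum.
  have hterm : ∀ i, 4 * ((s : ℝ) ^ 2 * ((((q : ℝ) ^ d i) - 1)⁻¹ ^ 2 * ∏ j with j < i, (1 + g j))) ≤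
      0.67 * (759⁻¹ : ℝ) ^ d i * (g i * ∏ j with j < i, (1 + g j)) := by
    intro i
    have h1 := hN _ (hd i)
    have h2 : (q : ℝ) ^ d i - 1 ≠ 0 := by linarith
    have h3 : 3 * (q : ℝ) ^ d i - 1 ≠ 0 := by linarith
    calc _ = 2 * (s : ℝ) ^ 2 / (3 * (q : ℝ) ^ d i - 1) * (g i * ∏ j with j < i, (1 + g j)) := by
          have h4 : g i = 2 * (3 * (q : ℝ) ^ d i - 1) / ((q : ℝ) ^ d i - 1) ^ 2 := rfl
          rw [h4]
          generalize ∏ j with j < i, (1 + g j) = c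
          generalize (q : ℝ) ^ d i = y at h2 h3
          have h5 : 2 * (s : ℝ) ^ 2 / (3 * y - 1) * (2 * (3 * y - 1) / (y - 1) ^ 2 * c) =
            (3 * y - 1) / (3 * y - 1) * (4 * (s : ℝ) ^ 2 * c / (y - 1) ^ 2) := by ring
          rw [h5, div_self h3, inv_pow]
          ring
      _ ≤ _ := mul_le_mul_of_nonneg_right (hc _ (hd i)) (mul_nonneg (hg0 i) (hprod _))
  -- Telescoping: `∏ (1 + g i) = 1 + ∑ g i * ∏ j < i, (1 + g j)`. Monotonicity of `d` keeps every `j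
  -- < i` among the primes of degree at most `m`.
  have hlevel : ∀ m, ∑ i with d i = m, g i * ∏ j with j < i, (1 + g j) ≤ 420 ^ m := by
    intro m
    calc _ ≤ ∑ i with d i ≤ m, g i * ∏ j with j < i, (1 + g j) :=
          sum_le_sum_of_subset_of_nonneg
            (fun i hi => by
              simp only [mem_filter, mem_univ, true_and] at hi ⊢
              exact hi.le)
            fun i _ _ => mul_nonneg (hg0 i) (hprod _)
      _ = ∑ i with d i ≤ m, g i * ∏ j ∈ {j | d j ≤ m} with j < i, (1 + g j) := by
          refine sum_congr rfl fun i hi => ?_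
          rw [filter_filter]
          congr 2
          ext j
          simp only [mem_filter, mem_univ, true_and] at hi ⊢
          exact ⟨fun h => ⟨(hmono h.le).trans hi, h⟩, fun h => h.2⟩
      _ ≤ ∏ i with d i ≤ m, (1 + g i) := by
          rw [prod_one_add_ordered]
          linarith
      _ ≤ _ := prod_one_add_momentFactor_le hq1 hd hcard m
  set M := ∑ i, d i + 1 with hM
  have hmaps : ∀ i ∈ (univ : Finset ι), d i ∈ Ico 1 M := fun i _ => by
    have := single_le_sum (f := d) (fun _ _ => Nat.zero_le _) (mem_univ i)
    have := hd i
    simp only [mem_Ico]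
    omega
  calc _ ≤ ∑ i, 0.67 * (759⁻¹ : ℝ) ^ d i * (g i * ∏ j with j < i, (1 + g j)) :=
        sum_le_sum fun i _ => hterm i
    _ = ∑ m ∈ Ico 1 M, 0.67 * (759⁻¹ : ℝ) ^ m *
          ∑ i with d i = m, g i * ∏ j with j < i, (1 + g j) := by
        rw [← sum_fiberwise_of_maps_to hmaps]
        refine sum_congr rfl fun m _ => ?_
        rw [mul_sum]
        exact sum_congr rfl fun i hi => by rw [(mem_filter.1 hi).2]
    _ ≤ ∑ m ∈ Ico 1 M, 0.67 * (759⁻¹ : ℝ) ^ m * 420 ^ m :=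
        sum_le_sum fun m _ => mul_le_mul_of_nonneg_left (hlevel m) (by positivity)
    _ = 0.67 * ∑ m ∈ Ico 1 M, (759 / 420 : ℝ)⁻¹ ^ m := by
        rw [mul_sum]
        refine sum_congr rfl fun m _ => ?_
        rw [mul_assoc, ← mul_pow]
        norm_num
    -- A geometric series of ratio `420 / 759`; the bound is about 0.83.
    _ ≤ 0.67 * (759 / 420 - 1)⁻¹ :=
        mul_le_mul_of_nonneg_left (sum_Ico_inv_pow_le (by norm_num) M) (by norm_num)
    _ < 1 := by norm_num

end Numerics

/-! ### From congruences in `F[X]` to boxes -/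

section PolynomialRing

open Finset Function Polynomial UniqueFactorizationMonoid
open scoped BigOperators

/-- A surjective homomorphism of finite groups has fibres of density `1 / card`. -/
lemma expect_indicator_fiber {G H : Type*} [AddGroup G] [AddGroup H] [Fintype G]
    [Fintype H] (f : G →+ H) (hf : Surjective f) (h : H) :
    𝔼 y, {y | f y = h}.indicator (1 : G → ℝ) y = (Fintype.card H : ℝ)⁻¹ := by
  classical
  have h1 : ∀ b : H, #{y | f y = b} = #{y | f y = h} := fun b =>
    AddMonoidHom.card_fiber_eq_of_mem_range f (hf b) (hf h)
  have h2 : Fintype.card G = Fintype.card H * #{y | f y = h} := by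
    rw [← card_univ (α := G), card_eq_sum_card_fiberwise (f := f) (t := univ) (fun _ _ => by simp),
      sum_congr rfl fun b _ => h1 b]
    simp
  have h3 : 0 < Fintype.card G := Fintype.card_pos
  have h4 : #{y | f y = h} ≠ 0 := fun h0 => by simp [h2, h0] at h3
  rw [Fintype.expect_eq_sum_div_card, h2]
  simp only [Set.indicator_apply, Set.mem_ofPred_eq, Pi.one_apply, sum_boole]
  push_cast
  have h5 : (Fintype.card H : ℝ) ≠ 0 := by
    have : Nonempty H := ⟨h⟩
    exact_mod_cast Fintype.card_ne_zero
  have h6 : (#{y | f y = h} : ℝ) ≠ 0 := by exact_mod_cast h4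
  field_simp

variable {F : Type*} [Field F]

lemma natCard_quotient_span_singleton {f : F[X]} (hf : f.Monic) :
    Nat.card (F[X] ⧸ Ideal.span {f}) = Nat.card F ^ f.natDegree := by
  have : Module.Finite F (F[X] ⧸ Ideal.span {f}) := hf.finite_quotient
  rw [Module.natCard_eq_pow_finrank (K := F), finrank_quotient_span_eq_natDegree]

/-- Finitely many nonzero polynomials factor over finitely many monic irreducible polynomials,
which can be listed in order of their degrees. -/
lemma exists_monotone_irreducible_factors {κ : Type*} [Finite κ] (g : κ → F[X])
    (hg : ∀ k, g k ≠ 0) :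
    ∃ (n : ℕ) (p : Fin n → F[X]) (v : κ → Fin n → ℕ), Injective p ∧
      Monotone (fun i => (p i).natDegree) ∧ (∀ i, (p i).Monic) ∧ (∀ i, Irreducible (p i)) ∧
      ∀ k, Ideal.span {g k} = Ideal.span {∏ i, p i ^ v k i} := by
  classical
  have := Fintype.ofFinite κ
  set P : Finset F[X] := univ.biUnion fun k => (normalizedFactors (g k)).toFinset with hP
  have hPm : ∀ x ∈ P, Irreducible x ∧ x.Monic := fun x hx => by
    simp only [hP, mem_biUnion, Multiset.mem_toFinset] at hx
    obtain ⟨k, -, hx⟩ := hx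
    have := (Polynomial.mem_normalizedFactors_iff (hg k)).1 hx
    exact ⟨this.1, this.2.1⟩
  set e := P.equivFin.symm
  set σ := Tuple.sort fun i => (e i : F[X]).natDegree with hσ
  refine ⟨#P, fun i => e (σ i), fun k i => (normalizedFactors (g k)).count (e (σ i) : F[X]),
    Subtype.val_injective.comp (e.injective.comp σ.injective),
    Tuple.monotone_sort fun i => (e i : F[X]).natDegree, fun i => (hPm _ (e (σ i)).2).2,
    fun i => (hPm _ (e (σ i)).2).1, fun k => ?_⟩
  rw [Ideal.span_singleton_eq_span_singleton]
  refine (prod_normalizedFactors (hg k)).symm.trans (Associated.of_eq ?_)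
  rw [prod_multiset_count_of_subset _ P fun x hx => mem_biUnion.2 ⟨k, mem_univ k, hx⟩,
    ← prod_coe_sort P, ← Equiv.prod_comp e, ← Equiv.prod_comp σ]

variable [Finite F]

lemma finite_quotient_span_singleton {f : F[X]} (hf : f.Monic) : Finite (F[X] ⧸ Ideal.span {f}) := by
  have : Module.Finite F (F[X] ⧸ Ideal.span {f}) := hf.finite_quotient
  exact Module.finite_of_finite F

/-- There are at most `q ^ l` monic polynomials of degree `l`. -/
lemma card_filter_natDegree_le {ι : Type*} [Fintype ι] {p : ι → F[X]} (hinj : Injective p)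
    (hp : ∀ i, (p i).Monic) (l : ℕ) : #{i | (p i).natDegree = l} ≤ Nat.card F ^ l := by
  classical
  have := Fintype.ofFinite F
  rw [← Fintype.card_subtype, Nat.card_eq_fintype_card]
  have h1 : Injective fun (i : {i // (p i).natDegree = l}) (j : Fin l) => (p i).coeff j := by
    rintro ⟨i, hi⟩ ⟨j, hj⟩ h
    refine Subtype.ext (hinj (Polynomial.ext fun m => ?_))
    rcases lt_trichotomy m l with hm | rfl | hm
    · exact congrFun h ⟨m, hm⟩
    · have h2 := (hp i).coeff_natDegree
      have h3 := (hp j).coeff_natDegree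
      rw [hi] at h2
      rw [hj] at h3
      simp only
      rw [h2, h3]
    · simp only
      rw [coeff_eq_zero_of_natDegree_lt (hi.trans_lt hm),
        coeff_eq_zero_of_natDegree_lt (hj.trans_lt hm)]
  simpa using Fintype.card_le_of_injective _ h1

/-- Congruences to nonzero proper moduli, each repeated at most `s` times, do not cover `F[X]`. -/
lemma exists_forall_sub_notMem {s : ℕ} (hs : 1 ≤ s) (hq : 759 * s ^ 2 ≤ Nat.card F) {κ : Type*}
    [Finite κ] (a : κ → F[X]) (I : κ → Ideal F[X]) (hbot : ∀ k, I k ≠ ⊥) (htop : ∀ k, I k ≠ ⊤)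
    (hI : ∀ J, Nat.card {k // I k = J} ≤ s) : ∃ z, ∀ k, z - a k ∉ I k := by
  classical
  have := Fintype.ofFinite κ
  have hprin : ∀ k, ∃ g, I k = Ideal.span {g} := fun k =>
    (IsPrincipalIdealRing.principal (I k)).principal
  choose g hgI using hprin
  have hg : ∀ k, g k ≠ 0 := fun k h => hbot k (by rw [hgI, h]; simp)
  obtain ⟨n, p, v, hinj, hmono, hmonic, hirr, hspan⟩ := exists_monotone_irreducible_factors g hg
  replace hspan : ∀ k, I k = Ideal.span {∏ i, p i ^ v k i} := fun k => (hgI k).trans (hspan k)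
  -- Any common upper bound for the exponents of `p i` would do; the sum is one.
  set E : Fin n → ℕ := fun i => ∑ k, v k i with hE
  have hvE : ∀ k i, v k i ≤ E i := fun k i =>
    single_le_sum (f := fun k => v k i) (fun _ _ => Nat.zero_le _) (mem_univ k)
  have hfin : ∀ i m, Finite (F[X] ⧸ Ideal.span {p i ^ m}) := fun i m =>
    finite_quotient_span_singleton ((hmonic i).pow m)
  have hfintype : ∀ i m, Fintype (F[X] ⧸ Ideal.span {p i ^ m}) := fun i m => Fintype.ofFinite _
  have hle : ∀ k i, Ideal.span {p i ^ E i} ≤ Ideal.span {p i ^ v k i} := fun k i =>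
    Ideal.span_singleton_le_span_singleton.2 (pow_dvd_pow _ (hvE k i))
  set S : κ → ∀ i, Set (F[X] ⧸ Ideal.span {p i ^ E i}) := fun k i =>
    {y | Ideal.Quotient.factor (hle k i) y = Ideal.Quotient.mk _ (a k)} with hS
  have hq1 : 759 ≤ Nat.card F := le_trans (by nlinarith) hq
  have hq' : (759 : ℝ) ≤ Nat.card F := by exact_mod_cast hq1
  have hd : ∀ i, 1 ≤ (p i).natDegree := fun i => (hirr i).natDegree_pos
  obtain ⟨x, hx⟩ := exists_forall_exists_notMem_of_sum_lt_one (v := v) (S := S)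
    (N := fun i => (Nat.card F : ℝ) ^ (p i).natDegree) (s := s)
    (fun i => one_lt_pow₀ (by linarith) (by have := hd i; omega))
    (fun k hk => htop k (by rw [hspan, hk]; simp))
    (fun k i hki => by
      have : Subsingleton (F[X] ⧸ Ideal.span {p i ^ v k i}) :=
        Ideal.Quotient.subsingleton_iff.2 (by rw [hki]; simp)
      exact Set.eq_univ_of_forall fun y => Subsingleton.elim _ _)
    (fun k i => by
      refine le_of_eq ((expect_indicator_fiber
        (Ideal.Quotient.factor (hle k i) : _ →+* F[X] ⧸ Ideal.span {p i ^ v k i}).toAddMonoidHom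
        (Ideal.Quotient.factor_surjective (hle k i)) _).trans ?_)
      rw [← Nat.card_eq_fintype_card, natCard_quotient_span_singleton ((hmonic i).pow _),
        natDegree_pow, mul_comm, pow_mul]
      push_cast
      rw [inv_pow])
    -- Equal exponent vectors give equal moduli, so multiplicity bounds their repetition.
    (fun b => by
      refine le_trans ?_ (hI (Ideal.span {∏ i, p i ^ b i}))
      refine Nat.card_le_card_of_injective
        (fun k : {k // v k = b} => ⟨k.1, by rw [hspan, k.2]⟩) fun k l h => ?_
      exact Subtype.ext (congrArg (fun z => z.1) h))
    (sum_moment_lt_one hs hq hd hmono (card_filter_natDegree_le hinj hmonic))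
  have hcop : Pairwise (IsCoprime on fun i => Ideal.span {p i ^ E i}) := by
    intro i j hij
    refine (Ideal.isCoprime_span_singleton_iff _ _).2 (IsCoprime.pow ?_)
    refine (hirr i).coprime_iff_not_dvd.2 fun hdvd => hij (hinj ?_)
    exact eq_of_monic_of_associated (hmonic i) (hmonic j) ((hirr i).associated_of_dvd (hirr j) hdvd)
  obtain ⟨z, hz⟩ := Ideal.quotientInfToPiQuotient_surj hcop x
  obtain ⟨z, rfl⟩ := Ideal.Quotient.mk_surjective z
  refine ⟨z, fun k hk => ?_⟩
  obtain ⟨i, hi⟩ := hx k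
  refine hi ?_
  rw [← hz]
  change Ideal.Quotient.factor (hle k i) (Ideal.Quotient.mk _ z) = Ideal.Quotient.mk _ (a k)
  rw [Ideal.Quotient.factor_mk, Ideal.Quotient.mk_eq_mk_iff_sub_mem, Ideal.mem_span_singleton]
  rw [hspan, Ideal.mem_span_singleton] at hk
  exact (dvd_prod_of_mem (fun i => p i ^ v k i) (mem_univ i)).trans hk

/-- Zero moduli contribute only finitely many points, so they do not help to cover `F[X]`. -/
lemma CoveringSystem.false_of_count_le {s : ℕ} (hs : 1 ≤ s) (hq : 759 * s ^ 2 ≤ Nat.card F)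
    (A : CoveringSystem F[X]) (hA : ∀ I, A.count I ≤ s) : False := by
  classical
  obtain ⟨z, hz⟩ := exists_forall_sub_notMem hs hq
    (fun k : {k // A.modulus k ≠ ⊥} => A.residue k) (fun k => A.modulus k) (fun k => k.2)
    (fun k => A.modulus_ne_top k) (fun J => by
      refine le_trans ?_ (hA J)
      refine Nat.card_le_card_of_injective (fun k => ⟨k.1.1, k.2⟩) fun k l h => ?_
      exact Subtype.ext (Subtype.ext (congrArg (fun z => z.1) h)))
  have hne : ∀ k : {k // A.modulus k ≠ ⊥}, ∃ x ∈ A.modulus k, x ≠ 0 := fun k =>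
    (Submodule.ne_bot_iff (A.modulus k)).1 k.2
  choose g hg hg0 using hne
  -- `Q` lies in every nonzero modulus, so all of `z + Q * F[X]` avoids those congruences and must
  -- be covered by the finitely many residues of zero moduli.
  set Q := ∏ k, g k with hQ
  have hQ0 : Q ≠ 0 := prod_ne_zero_iff.2 fun k _ => hg0 k
  have hcov : ∀ t : F[X], ∃ i, z + Q * t = A.residue i := by
    intro t
    have h1 : z + Q * t ∈ ⋃ i, {x : F[X] | x - A.residue i ∈ A.modulus i} :=
      A.covers ▸ Set.mem_univ _
    obtain ⟨i, hi⟩ := Set.mem_iUnion.1 h1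
    rw [Set.mem_ofPred_eq] at hi
    by_cases hb : A.modulus i = ⊥
    · rw [hb, Ideal.mem_bot, sub_eq_zero] at hi
      exact ⟨i, hi⟩
    · refine absurd ?_ (hz ⟨i, hb⟩)
      have h2 : Q * t ∈ A.modulus i := Ideal.mul_mem_right _ _
        (Ideal.mem_of_dvd _ (dvd_prod_of_mem g (mem_univ ⟨i, hb⟩)) (hg ⟨i, hb⟩))
      have h3 := sub_mem hi h2
      rwa [show z + Q * t - A.residue i - Q * t = z - A.residue i by ring] at h3
  choose c hc using hcov
  obtain ⟨t, u, htu, h⟩ := Finite.exists_ne_map_eq_of_infinite c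
  have h1 := (hc t).trans ((congrArg A.residue h).trans (hc u).symm)
  exact htu (mul_left_cancel₀ hQ0 (add_left_cancel h1))

end PolynomialRing

theorem corollary1p2 (F : Type*) [Field F] [Finite F] :
    (∀ s : ℕ, 1 ≤ s → 759 * s ^ 2 ≤ Nat.card F →
      ¬ ∃ A : CoveringSystem (Polynomial F), A.multiplicity = s) ∧
    (759 ≤ Nat.card F →
      ¬ ∃ A : CoveringSystem (Polynomial F), Function.Injective A.modulus) := by
  refine ⟨fun s hs hq => ?_, fun hq => ?_⟩
  · rintro ⟨A, rfl⟩
    exact A.false_of_count_le hs hq fun I => A.isGreatest_multiplicity.2 ⟨I, rfl⟩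
  · rintro ⟨A, hA⟩
    refine A.false_of_count_le le_rfl (by simpa using hq) fun I => ?_
    have : Subsingleton {i : Fin A.m // A.modulus i = I} :=
      ⟨fun i j => Subtype.ext (hA (i.2.trans j.2.symm))⟩
    exact Finite.card_le_one_iff_subsingleton.2 this
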